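/- **Theorem 1.** Let $\mathcal G=(\mathcal V,\mathcal E)$ be a strongly connected digraph with $n$ nodes $v_1,\dots,v_n$. Write $\mathcal N_j^-$ and $\mathcal N_j^+$ for the sets of in- and out-neighbours of $v_j$ other than $v_j$ itself, $d_j^+=|\mathcal N_j^+|$, and $p_{lj}=\frac1{1+d_j^+}$ if $v_l\in\mathcal N_j^+\cup\{v_j\}$, $p_{lj}=0$ otherwise. For each link $(j,i)$, i.e. $v_i\in\mathcal N_j^-$, let $\bar\tau_{ji}\in\mathbb N$ be a retransmission limit and $q_{ji}\in[0,1)$ an error probability. At every time $k\ge 0$ node $v_i$ starts to transmit a new packet on each link $(j,i)$. Let $\tau_{ji}[k]\in\{0,\dots,\bar\tau_{ji}+1\}$ be the number of failed trials of this packet; there is one trial in each of the slots $k,k+1,\dots$, the packet is received in slot $k+\tau_{ji}[k]$ if $\tau_{ji}[k]\le\bar\tau_{ji}$, and it is dropped at the end of slot $k+\bar\tau_{ji}$ if $\tau_{ji}[k]=\bar\tau_{ji}+1$. The random variables $\tau_{ji}[k]$ (over all links and all $k$) are independent, with $$\mathbb P(\tau_{ji}[k]=r)=q_{ji}^{\,r}(1-q_{ji})\quad(0\le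 r\le\bar\tau_{ji}),\qquad \mathbb P(\tau_{ji}[k]=\bar\tau_{ji}+1)=q_{ji}^{\,\bar\tau_{ji}+1}.$$ The ARQ-based Ratio Consensus algorithm runs as follows. Let $x_j[0]\in\mathbb R$ be arbitrary, and let the running sums $\sigma_{ji}$ and the received sums $\chi_{ji}$ of all links start at $0$. In slot $k$, on each link $(j,i)$: * the new packet has the content $w_{ji}[k]=p_{ji}x_i[k]+a_{ji}[k]$, where $a_{ji}[k]$ is either $0$ or the whole withheld amount $\sigma_{ji}[k]-\chi_{ji}[k]$; which of the two is decided, for each link and each slot, by an arbitrary rule, which may depend on the realization of the delays. (Examples: never attach; always attach; attach exactly when $\tau_{ji}[k]\le\bar\tau_{ji}$.) * $\sigma_{ji}[k+1]=\sigma_{ji}[k]-a_{ji}[k]+w_{ji}[k-\bar\tau_{ji}]$ if $k\ge\bar\tau_{ji}$ and $\tau_{ji}[k-\bar\tau_{ji}]\ge\bar\tau_{ji}$ (a packet is at its last trial), and $\sigma_{ji}[k+1]=\sigma_{ji}[k]-a_{ji}[k]$ otherwise; * $\chi_{ji}[k+1]=\sigma_{ji}[k+1]$ if $k\ge\bar\tau_{ji}$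 and $\tau_{ji}[k-\bar\tau_{ji}]=\bar\tau_{ji}$ (the last trial succeeds), and $\chi_{ji}[k+1]=\chi_{ji}[k]$ otherwise. Then $$x_j[k+1]=p_{jj}x_j[k]+\sum_{v_i\in\mathcal N_j^-}\Big(\sum_{\substack{0\le r<\bar\tau_{ji},\ r\le k\\ \tau_{ji}[k-r]=r}}w_{ji}[k-r]+\chi_{ji}[k+1]-\chi_{ji}[k]\Big).$$ The variables $y_j[k]$ are produced by the same iteration (same delays, same attachment decisions, own running sums $\eta_{ji}$ and received sums $\psi_{ji}$) from $y_j[0]=1$, and $z_j[k]=x_j[k]/y_j[k]$. Then, almost surely, for every node $v_j$: $y_j[k]>0$ for all $k$, and $$\lim_{k\to\infty}z_j[k]=\frac1n\sum_{i=1}^n x_i[0].$$ -/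

import Mathlib

open MeasureTheory ProbabilityTheory Filter Topology

noncomputable section

namespace ARQ

variable {V : Type*} [Fintype V]

/-- Every node can be reached from every node; `G.Adj i j` means that `i` transmits to `j`. -/
def StronglyConnected (G : Digraph V) : Prop :=
  ∀ i j : V, Relation.ReflTransGen G.Adj i j

open Classical in
/-- The in-neighbours of `j`, other than `j` itself. -/
def inNbrs (G : Digraph V) (j : V) : Finset V :=
  Finset.univ.filter fun i => i ≠ j ∧ G.Adj i j

open Classical in
/-- The out-neighbours of `i`, other than `i` itself. -/
def outNbrs (G : Digraph V) (i : V) : Finset V :=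
  Finset.univ.filter fun j => j ≠ i ∧ G.Adj i j

open Classical in
/-- The weight `p_{ji}` that node `i` puts on the link to `j` (and on itself). -/
def weight (G : Digraph V) (j i : V) : ℝ :=
  if j = i ∨ j ∈ outNbrs G i then 1 / (1 + ((outNbrs G i).card : ℝ)) else 0

/-- A communication link `(j, i)`, from `i` to `j`; the self-loops are not links. -/
def Link (G : Digraph V) : Type _ := {e : V × V // e.2 ∈ inNbrs G e.1}

/-- The quantities of one consensus iteration at the start of a time slot. The algorithm runs two
copies in parallel: one for the states `x` (with running sums `σ` and received sums `χ`), one for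
the states `y` (with running sums `η` and received sums `ψ`). -/
structure State (V : Type*) where
  /-- the state of each node -/
  val : V → ℝ
  /-- `sent r j i`: the content of the packet whose first transmission, on the link from `i` to
  `j`, was `r + 1` slots ago (`0` before time `0`) -/
  sent : ℕ → V → V → ℝ
  /-- `sum j i`: the running sum kept by `i` for its out-neighbour `j` -/
  sum : V → V → ℝ
  /-- `recv j i`: the last running sum of `i` that has reached `j` -/
  recv : V → V → ℝ

/-- Initially nothing has been sent, and all running sums vanish. -/
def State.init (v : V → ℝ) : State V where
  val := v
  sent := fun _ _ _ => 0
  sum := fun _ _ => 0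
  recv := fun _ _ => 0

/-- The part of the withheld amount `sum - recv` (mass of dropped packets) that `i` adds to its new
packet for `j`: all of it if `attach`, and nothing otherwise. -/
def attached (attach : V → V → Prop) (S : State V) (j i : V) : ℝ :=
  open Classical in if attach j i then S.sum j i - S.recv j i else 0

/-- The content of the packet first transmitted `r` slots ago on the link from `i` to `j`;
the packet with `r = 0` is the new one. -/
def content (G : Digraph V) (attach : V → V → Prop) (S : State V) : ℕ → V → V → ℝ
  | 0, j, i => weight G j i * S.val i + attached attach S j i
  | r + 1, j, i => S.sent r j i

/-- The new running sum. A packet that was first transmitted at time `k - τbar j i` and has not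
been received before time `k` is at its last trial at time `k`, and its content is added to the
running sum. What has been attached to the new packet leaves the running sum. -/
def newSum (G : Digraph V) (τbar : V → V → ℕ) (τ : V → V → ℕ → ℕ) (attach : V → V → Prop)
    (k : ℕ) (S : State V) (j i : V) : ℝ :=
  S.sum j i - attached attach S j i +
    if τbar j i ≤ k ∧ τbar j i ≤ τ j i (k - τbar j i) then
      content G attach S (τbar j i) j i
    else 0

/-- The new received sum: the running sum reaches `j` if the last trial succeeds. If the last trial
fails, the packet is dropped, and the received sum does not change. -/
def newRecv (G : Digraph V) (τbar : V → V → ℕ) (τ : V → V → ℕ → ℕ) (attach : V → V → Prop)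
    (k : ℕ) (S : State V) (j i : V) : ℝ :=
  if τbar j i ≤ k ∧ τ j i (k - τbar j i) = τbar j i then
    newSum G τbar τ attach k S j i
  else S.recv j i

/-- Time slot `k` of the algorithm. Node `j` adds up its own weighted state, the packets that
arrive during this slot before their last trial, and the increments of the received sums. -/
def step (G : Digraph V) (τbar : V → V → ℕ) (τ : V → V → ℕ → ℕ) (attach : V → V → Prop)
    (k : ℕ) (S : State V) : State V where
  val := fun j => weight G j j * S.val j + ∑ i ∈ inNbrs G j,
    ((∑ r ∈ Finset.range (τbar j i),
        if r ≤ k ∧ τ j i (k - r) = r then content G attach S r j i else 0) +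
      (newRecv G τbar τ attach k S j i - S.recv j i))
  sent := content G attach S
  sum := newSum G τbar τ attach k S
  recv := newRecv G τbar τ attach k S

/-- The algorithm, started from `v`. Here `τbar j i` is the retransmission limit of the link from
`i` to `j`; `τ j i k` is the number of failed trials of the packet first transmitted at time `k`
on this link, with `τ j i k = τbar j i + 1` for a dropped packet; and `attach k j i` says whether
`i` adds the amount withheld for `j` to its packet of time `k`. If this is never done, withheld
amounts travel only as running sums at last trials; if it is always done, they travel with the next
packet; with `attach k j i := τ j i k ≤ τbar j i` they stay in a buffer until the next packet that
is not dropped, and arrive with it. -/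
def run (G : Digraph V) (τbar : V → V → ℕ) (τ : V → V → ℕ → ℕ) (attach : ℕ → V → V → Prop)
    (v : V → ℝ) : ℕ → State V
  | 0 => State.init v
  | k + 1 => step G τbar τ (attach k) k (run G τbar τ attach v k)

/-- The law of the delays: on the link from `i` to `j` each trial fails with probability `q j i`,
independently of all other trials on all links, and there are at most `τbar j i + 1` trials. -/
structure IsARQDelay {Ω : Type*} [MeasurableSpace Ω] (μ : Measure Ω) (G : Digraph V)
    (τbar : V → V → ℕ) (q : V → V → ℝ) (τ : V → V → ℕ → Ω → ℕ) : Prop where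
  measurable : ∀ j, ∀ i ∈ inNbrs G j, ∀ k, Measurable (τ j i k)
  prob_delay : ∀ j, ∀ i ∈ inNbrs G j, ∀ k, ∀ r ≤ τbar j i,
    μ.real {ω | τ j i k ω = r} = q j i ^ r * (1 - q j i)
  prob_drop : ∀ j, ∀ i ∈ inNbrs G j, ∀ k,
    μ.real {ω | τ j i k ω = τbar j i + 1} = q j i ^ (τbar j i + 1)
  indep : iIndepFun (fun (a : Link G × ℕ) => τ a.1.1.1 a.1.1.2 a.2) μ

end ARQ

end

/-! Apart from one use of the second Borel–Cantelli lemma, the argument is pathwise. For fixed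
delays and attachment decisions the iteration is linear (`run_comb`), preserves the cone
`State.Nonneg`, and conserves the total mass in nodes, in flight and withheld (`mass_run`).

The mixing takes place in windows where packets succeed exactly at their last trial. Such a success
sets `recv = sum`, and under a rule that never attaches it is the only way for withheld mass to
arrive. Links with error probability zero cannot show this pattern unless their retransmission limit
is zero, but nothing is ever withheld on them. So inside a window both runs soon carry plain
weighted values in their packets, and a fixed fraction of the mass reaches every node. Hence a run
in the cone before the window remains in it afterwards even if `ε` times the average of its initial
values is subtracted from each of them (`exists_contraction`).

Let `c` be the average of `x₀` and `d = ±(x₀ - c)`, which has sum zero. The run from `d + C` starts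
in the cone for large `C`, and after `m` windows `C` may be replaced by `C * (1 - ε) ^ m`. By
linearity this reads `|x - c * y| ≤ C * (1 - ε) ^ m * y`, so `x / y` tends to `c` (`tendsto_ratio`).
Almost surely such windows recur forever (`ae_frequently_block`). Since `ε` and the window length
are uniform in the attachment rule, that rule may depend on the realization. -/

noncomputable section

namespace ARQ

variable {V : Type*} [Fintype V]

/-! ### One slot: positivity, conservation of mass, linearity -/

section Step

variable {G : Digraph V} {τbar : V → V → ℕ} {τ : V → V → ℕ → ℕ} {att : V → V → Prop}
  {k : ℕ} {S T : State V} {i j : V}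

/-- All amounts held by the nodes, contained in packets, or withheld are nonnegative. -/
structure State.Nonneg (G : Digraph V) (τbar : V → V → ℕ) (S : State V) : Prop where
  val : ∀ j, 0 ≤ S.val j
  sent : ∀ j, ∀ i ∈ inNbrs G j, ∀ r < τbar j i, 0 ≤ S.sent r j i
  withheld : ∀ j, ∀ i ∈ inNbrs G j, S.recv j i ≤ S.sum j i

theorem attached_nonneg (hS : S.Nonneg G τbar) (hi : i ∈ inNbrs G j) :
    0 ≤ attached att S j i := by
  have := hS.withheld j i hi
  unfold attached
  split_ifs <;> linarith

theorem attached_le (hS : S.Nonneg G τbar) (hi : i ∈ inNbrs G j) :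
    attached att S j i ≤ S.sum j i - S.recv j i := by
  have := hS.withheld j i hi
  unfold attached
  split_ifs <;> linarith

omit [Fintype V] in
theorem attached_of_sum_eq_recv (h : S.sum j i = S.recv j i) : attached att S j i = 0 := by
  simp [attached, h]

theorem weight_nonneg (G : Digraph V) (j i : V) : 0 ≤ weight G j i := by
  unfold weight
  split_ifs <;> positivity

theorem weight_le_one (G : Digraph V) (j i : V) : weight G j i ≤ 1 := by
  unfold weight
  split_ifs
  · rw [div_le_one (by positivity)]
    linarith [(Nat.cast_nonneg (outNbrs G i).card : (0 : ℝ) ≤ _)]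
  · exact zero_le_one

theorem mem_outNbrs_iff : j ∈ outNbrs G i ↔ i ∈ inNbrs G j := by
  simp [outNbrs, inNbrs, ne_comm]

/-- A positive lower bound of all nonzero weights. -/
def minWeight (V : Type*) [Fintype V] : ℝ := 1 / (1 + (Fintype.card V : ℝ))

theorem minWeight_pos : 0 < minWeight V := by
  unfold minWeight
  positivity

theorem minWeight_le_one : minWeight V ≤ 1 := by
  unfold minWeight
  rw [div_le_one (by positivity)]
  linarith [(Nat.cast_nonneg (Fintype.card V) : (0 : ℝ) ≤ _)]

theorem minWeight_le_weight (h : j = i ∨ i ∈ inNbrs G j) : minWeight V ≤ weight G j i := by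
  unfold weight minWeight
  rw [if_pos (by rwa [mem_outNbrs_iff])]
  have : ((outNbrs G i).card : ℝ) ≤ Fintype.card V := by exact_mod_cast Finset.card_le_univ _
  gcongr

/-- Column stochasticity: each node splits its value evenly among itself and its out-neighbours. -/
theorem sum_weight_mul (G : Digraph V) (f : V → ℝ) :
    ∑ j, (weight G j j * f j + ∑ i ∈ inNbrs G j, weight G j i * f i) = ∑ j, f j := by
  rw [Finset.sum_add_distrib,
    Finset.sum_comm' (t' := Finset.univ) (s' := fun i => outNbrs G i)
      (by intro x y; simp [mem_outNbrs_iff]), ← Finset.sum_add_distrib]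
  refine Finset.sum_congr rfl fun i _ => ?_
  have h : ∀ j ∈ outNbrs G i, weight G j i * f i
      = 1 / (1 + ((outNbrs G i).card : ℝ)) * f i := by
    intro j hj
    rw [weight, if_pos (Or.inr hj)]
  rw [Finset.sum_congr rfl h, Finset.sum_const, weight, if_pos (Or.inl rfl), nsmul_eq_mul]
  have : (1 + ((outNbrs G i).card : ℝ)) ≠ 0 := by positivity
  field_simp

theorem content_nonneg (hS : S.Nonneg G τbar) (hi : i ∈ inNbrs G j) {r : ℕ}
    (hr : r ≤ τbar j i) : 0 ≤ content G att S r j i := by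
  cases r with
  | zero =>
    exact add_nonneg (mul_nonneg (weight_nonneg _ _ _) (hS.val _)) (attached_nonneg hS hi)
  | succ r => exact hS.sent j i hi r hr

theorem weight_mul_le_content (hS : S.Nonneg G τbar) (hi : i ∈ inNbrs G j) :
    weight G j i * S.val i ≤ content G att S 0 j i :=
  le_add_of_nonneg_right (attached_nonneg hS hi)

theorem recv_le_newSum (hS : S.Nonneg G τbar) (hi : i ∈ inNbrs G j) :
    S.recv j i ≤ newSum G τbar τ att k S j i := by
  have h1 := attached_le (att := att) hS hi
  have h2 := content_nonneg (att := att) hS hi le_rfl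
  unfold newSum
  split_ifs <;> linarith

theorem recv_le_newRecv (hS : S.Nonneg G τbar) (hi : i ∈ inNbrs G j) :
    S.recv j i ≤ newRecv G τbar τ att k S j i := by
  unfold newRecv
  split_ifs
  exacts [recv_le_newSum hS hi, le_rfl]

theorem newRecv_le_newSum (hS : S.Nonneg G τbar) (hi : i ∈ inNbrs G j) :
    newRecv G τbar τ att k S j i ≤ newSum G τbar τ att k S j i := by
  unfold newRecv
  split_ifs
  exacts [le_rfl, recv_le_newSum hS hi]

/-- The amount that reaches `j` from `i` in slot `k`. -/
def arrival (G : Digraph V) (τbar : V → V → ℕ) (τ : V → V → ℕ → ℕ) (att : V → V → Prop)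
    (k : ℕ) (S : State V) (j i : V) : ℝ :=
  (∑ r ∈ Finset.range (τbar j i),
      if r ≤ k ∧ τ j i (k - r) = r then content G att S r j i else 0) +
    (newRecv G τbar τ att k S j i - S.recv j i)

theorem step_val (j : V) : (step G τbar τ att k S).val j
    = weight G j j * S.val j + ∑ i ∈ inNbrs G j, arrival G τbar τ att k S j i := rfl

theorem early_arrival_nonneg (hS : S.Nonneg G τbar) (hi : i ∈ inNbrs G j) {r : ℕ}
    (hr : r ∈ Finset.range (τbar j i)) :
    0 ≤ if r ≤ k ∧ τ j i (k - r) = r then content G att S r j i else 0 := by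
  split_ifs
  exacts [content_nonneg hS hi (Finset.mem_range.1 hr).le, le_rfl]

theorem arrival_nonneg (hS : S.Nonneg G τbar) (hi : i ∈ inNbrs G j) :
    0 ≤ arrival G τbar τ att k S j i :=
  add_nonneg (Finset.sum_nonneg fun _ hr => early_arrival_nonneg hS hi hr)
    (sub_nonneg.2 (recv_le_newRecv hS hi))

theorem content_le_arrival (hS : S.Nonneg G τbar) (hi : i ∈ inNbrs G j) {r : ℕ}
    (hr : r ≤ τbar j i) (hk : r ≤ k) (hτ : τ j i (k - r) = r) :
    content G att S r j i ≤ arrival G τbar τ att k S j i := by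
  rcases hr.lt_or_eq with hr | rfl
  · refine le_add_of_le_of_nonneg ?_ (sub_nonneg.2 (recv_le_newRecv hS hi))
    have := Finset.single_le_sum
      (fun _ hr => early_arrival_nonneg (τ := τ) (k := k) (att := att) hS hi hr)
      (Finset.mem_range.2 hr)
    rwa [if_pos ⟨hk, hτ⟩] at this
  -- At the last trial the content arrives through the running sum. The attached part leaving that
  -- sum is at most `sum - recv`, so the increment of `recv` is at least the content.
  · refine le_add_of_nonneg_of_le
      (Finset.sum_nonneg fun _ hr => early_arrival_nonneg hS hi hr) ?_
    rw [newRecv, if_pos ⟨hk, hτ⟩, newSum, if_pos ⟨hk, hτ.ge⟩]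
    linarith [attached_le (att := att) hS hi]

theorem arrival_le_step_val (hS : S.Nonneg G τbar) (hi : i ∈ inNbrs G j) :
    arrival G τbar τ att k S j i ≤ (step G τbar τ att k S).val j := by
  rw [step_val]
  exact le_add_of_nonneg_of_le (mul_nonneg (weight_nonneg _ _ _) (hS.val _))
    (Finset.single_le_sum (fun _ h => arrival_nonneg hS h) hi)

theorem weight_mul_le_step_val (hS : S.Nonneg G τbar) (j : V) :
    weight G j j * S.val j ≤ (step G τbar τ att k S).val j := by
  rw [step_val]
  exact le_add_of_nonneg_right (Finset.sum_nonneg fun _ h => arrival_nonneg hS h)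

theorem State.Nonneg.step (hS : S.Nonneg G τbar) : (step G τbar τ att k S).Nonneg G τbar where
  val j := (mul_nonneg (weight_nonneg _ _ _) (hS.val _)).trans (weight_mul_le_step_val hS j)
  sent _ _ hi _ hr := content_nonneg hS hi hr.le
  withheld _ _ hi := newRecv_le_newSum hS hi

/-- The content of the packets on the link from `i` to `j` that are still to be transmitted at
the start of slot `k`. -/
def inFlight (τbar : V → V → ℕ) (τ : V → V → ℕ → ℕ) (k : ℕ) (S : State V) (j i : V) : ℝ :=
  ∑ r ∈ Finset.range (τbar j i),
    if r + 1 ≤ k ∧ r + 1 ≤ τ j i (k - (r + 1)) then S.sent r j i else 0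

/-- The total amount in the nodes, in packets in flight, and withheld. -/
def mass (G : Digraph V) (τbar : V → V → ℕ) (τ : V → V → ℕ → ℕ) (k : ℕ) (S : State V) : ℝ :=
  ∑ j, (S.val j + ∑ i ∈ inNbrs G j, (S.sum j i - S.recv j i + inFlight τbar τ k S j i))

/-- Conservation on one link: a packet under trial arrives, stays in flight, or enters the running
sum at its last trial; the attached amount only moves from the withheld part into the new packet. -/
theorem arrival_add_rest :
    arrival G τbar τ att k S j i +
      ((step G τbar τ att k S).sum j i - (step G τbar τ att k S).recv j i
        + inFlight τbar τ (k + 1) (step G τbar τ att k S) j i)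
    = weight G j i * S.val i + (S.sum j i - S.recv j i + inFlight τbar τ k S j i) := by
  have h1 : (∑ r ∈ Finset.range (τbar j i),
        if r ≤ k ∧ τ j i (k - r) = r then content G att S r j i else 0) +
      inFlight τbar τ (k + 1) (step G τbar τ att k S) j i
      = ∑ r ∈ Finset.range (τbar j i),
        if r ≤ k ∧ r ≤ τ j i (k - r) then content G att S r j i else 0 := by
    rw [inFlight, ← Finset.sum_add_distrib]
    refine Finset.sum_congr rfl fun r _ => ?_
    rw [Nat.add_sub_add_right]
    change _ + (if _ then content G att S r j i else 0) = _
    by_cases hk : r ≤ k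
    · rcases lt_trichotomy (τ j i (k - r)) r with h | h | h
      · simp [hk, h.ne, h.not_ge, (h.trans (Nat.lt_succ_self r)).not_ge]
      · simp [hk, h]
      · simp [hk, h.ne', h.le, Nat.succ_le_of_lt h]
    · simp [hk]
  -- The sum over ages `0, …, τbar j i` is split twice: at the top it gives off the last trial, at
  -- the bottom the new packet, leaving the older packets in flight.
  have h2 : (∑ r ∈ Finset.range (τbar j i),
        if r ≤ k ∧ r ≤ τ j i (k - r) then content G att S r j i else 0)
      + (if τbar j i ≤ k ∧ τbar j i ≤ τ j i (k - τbar j i) then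
          content G att S (τbar j i) j i else 0)
      = content G att S 0 j i + inFlight τbar τ k S j i := by
    rw [← Finset.sum_range_succ (fun r =>
      if r ≤ k ∧ r ≤ τ j i (k - r) then content G att S r j i else 0), Finset.sum_range_succ',
      add_comm]
    congr 1
  have h3 : (step G τbar τ att k S).sum j i = S.sum j i - attached att S j i +
      (if τbar j i ≤ k ∧ τbar j i ≤ τ j i (k - τbar j i) then
          content G att S (τbar j i) j i else 0) := rfl
  have h4 : (step G τbar τ att k S).recv j i = newRecv G τbar τ att k S j i := rfl
  have h5 : content G att S 0 j i = weight G j i * S.val i + attached att S j i := rfl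
  unfold arrival
  linarith

theorem mass_step : mass G τbar τ (k + 1) (step G τbar τ att k S) = mass G τbar τ k S := by
  unfold mass
  simp only [step_val, add_assoc, ← Finset.sum_add_distrib, arrival_add_rest]
  simp only [Finset.sum_add_distrib, ← sum_weight_mul G S.val]
  ring

theorem inFlight_nonneg (hS : S.Nonneg G τbar) (hi : i ∈ inNbrs G j) :
    0 ≤ inFlight τbar τ k S j i := by
  refine Finset.sum_nonneg fun r hr => ?_
  split_ifs
  exacts [hS.sent j i hi r (Finset.mem_range.1 hr), le_rfl]

theorem val_le_mass (hS : S.Nonneg G τbar) (j : V) : S.val j ≤ mass G τbar τ k S := by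
  have h : ∀ j, 0 ≤ ∑ i ∈ inNbrs G j, (S.sum j i - S.recv j i + inFlight τbar τ k S j i) :=
    fun j => Finset.sum_nonneg fun i hi =>
      add_nonneg (sub_nonneg.2 (hS.withheld j i hi)) (inFlight_nonneg hS hi)
  refine (le_add_of_nonneg_right (h j)).trans ?_
  exact Finset.single_le_sum (f := fun j => S.val j + ∑ i ∈ inNbrs G j,
    (S.sum j i - S.recv j i + inFlight τbar τ k S j i))
    (fun j _ => add_nonneg (hS.val j) (h j)) (Finset.mem_univ j)

/-- The linear combination of two states. -/
def State.comb (a b : ℝ) (S T : State V) : State V where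
  val := fun j => a * S.val j + b * T.val j
  sent := fun r j i => a * S.sent r j i + b * T.sent r j i
  sum := fun j i => a * S.sum j i + b * T.sum j i
  recv := fun j i => a * S.recv j i + b * T.recv j i

omit [Fintype V] in
theorem attached_comb (a b : ℝ) : attached att (State.comb a b S T) j i
    = a * attached att S j i + b * attached att T j i := by
  unfold attached State.comb
  split_ifs <;> ring

theorem content_comb (a b : ℝ) (r : ℕ) : content G att (State.comb a b S T) r j i
    = a * content G att S r j i + b * content G att T r j i := by
  cases r with
  | zero =>
    simp only [content, attached_comb]
    simp only [State.comb]
    ring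
  | succ r => rfl

theorem newSum_comb (a b : ℝ) : newSum G τbar τ att k (State.comb a b S T) j i
    = a * newSum G τbar τ att k S j i + b * newSum G τbar τ att k T j i := by
  simp only [newSum, attached_comb, content_comb]
  simp only [State.comb]
  split_ifs <;> ring

theorem newRecv_comb (a b : ℝ) : newRecv G τbar τ att k (State.comb a b S T) j i
    = a * newRecv G τbar τ att k S j i + b * newRecv G τbar τ att k T j i := by
  simp only [newRecv, newSum_comb]
  split_ifs <;> rfl

theorem arrival_comb (a b : ℝ) : arrival G τbar τ att k (State.comb a b S T) j i
    = a * arrival G τbar τ att k S j i + b * arrival G τbar τ att k T j i := by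
  have h : ∀ r, (if r ≤ k ∧ τ j i (k - r) = r then content G att (State.comb a b S T) r j i else 0)
      = a * (if r ≤ k ∧ τ j i (k - r) = r then content G att S r j i else 0)
        + b * (if r ≤ k ∧ τ j i (k - r) = r then content G att T r j i else 0) := by
    intro r
    rw [content_comb]
    split_ifs <;> ring
  simp only [arrival, newRecv_comb, h, Finset.sum_add_distrib, ← Finset.mul_sum]
  simp only [State.comb]
  ring

theorem step_comb (a b : ℝ) : step G τbar τ att k (State.comb a b S T)
    = State.comb a b (step G τbar τ att k S) (step G τbar τ att k T) := by
  have hv : (step G τbar τ att k (State.comb a b S T)).val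
      = (State.comb a b (step G τbar τ att k S) (step G τbar τ att k T)).val := by
    funext j
    rw [step_val]
    simp only [arrival_comb, Finset.sum_add_distrib, ← Finset.mul_sum]
    simp only [State.comb, step_val]
    ring
  have hs : (step G τbar τ att k (State.comb a b S T)).sent
      = (State.comb a b (step G τbar τ att k S) (step G τbar τ att k T)).sent := by
    funext r j i
    exact content_comb a b r
  have hu : (step G τbar τ att k (State.comb a b S T)).sum
      = (State.comb a b (step G τbar τ att k S) (step G τbar τ att k T)).sum := by
    funext j i
    exact newSum_comb a b
  have hr : (step G τbar τ att k (State.comb a b S T)).recv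
      = (State.comb a b (step G τbar τ att k S) (step G τbar τ att k T)).recv := by
    funext j i
    exact newRecv_comb a b
  generalize step G τbar τ att k (State.comb a b S T) = A at *
  generalize State.comb a b (step G τbar τ att k S) (step G τbar τ att k T) = B at *
  cases A
  cases B
  simp_all

end Step

/-! ### Whole runs: invariants, spreading of mass, mixing in good windows -/

section Run

variable {G : Digraph V} {τbar : V → V → ℕ} {τ : V → V → ℕ → ℕ} {att : ℕ → V → V → Prop}
  {v w : V → ℝ} {i j : V}

theorem nonneg_run_add {k : ℕ} (h : (run G τbar τ att v k).Nonneg G τbar) (m : ℕ) :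
    (run G τbar τ att v (k + m)).Nonneg G τbar := by
  induction m with
  | zero => exact h
  | succ m ih => exact ih.step

theorem nonneg_run_of_le {k l : ℕ} (h : (run G τbar τ att v k).Nonneg G τbar) (hkl : k ≤ l) :
    (run G τbar τ att v l).Nonneg G τbar := by
  obtain ⟨m, rfl⟩ := Nat.exists_eq_add_of_le hkl
  exact nonneg_run_add h m

theorem nonneg_run_zero (hv : ∀ j, 0 ≤ v j) : (run G τbar τ att v 0).Nonneg G τbar :=
  ⟨hv, fun _ _ _ _ _ => le_rfl, fun _ _ _ => le_rfl⟩

theorem run_comb (a b : ℝ) (k : ℕ) : run G τbar τ att (fun j => a * v j + b * w j) k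
    = State.comb a b (run G τbar τ att v k) (run G τbar τ att w k) := by
  induction k with
  | zero => simp [run, State.init, State.comb]
  | succ k ih => simp only [run, ih, step_comb]

theorem mass_run (k : ℕ) : mass G τbar τ k (run G τbar τ att v k) = ∑ j, v j := by
  induction k with
  | zero => simp [mass, run, State.init, inFlight]
  | succ k ih => rw [run, mass_step, ih]

theorem val_run_le_sum {k : ℕ} (h : (run G τbar τ att v k).Nonneg G τbar) (j : V) :
    (run G τbar τ att v k).val j ≤ ∑ i, v i :=
  (val_le_mass h j).trans_eq (mass_run k)

/-- Contents are frozen at the first transmission; retransmission only shifts the age. -/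
theorem content_run_add (t r : ℕ) :
    content G (att (t + r)) (run G τbar τ att v (t + r)) r j i
      = content G (att t) (run G τbar τ att v t) 0 j i := by
  induction r with
  | zero => rfl
  | succ r ih => exact ih

theorem pow_mul_val_run_le {k : ℕ} (h : (run G τbar τ att v k).Nonneg G τbar) (m : ℕ) (j : V) :
    minWeight V ^ m * (run G τbar τ att v k).val j ≤ (run G τbar τ att v (k + m)).val j := by
  induction m with
  | zero => simp
  | succ m ih =>
    have h1 := nonneg_run_add h m
    calc minWeight V ^ (m + 1) * (run G τbar τ att v k).val j
        = minWeight V * (minWeight V ^ m * (run G τbar τ att v k).val j) := by ring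
      _ ≤ minWeight V * (run G τbar τ att v (k + m)).val j :=
        mul_le_mul_of_nonneg_left ih minWeight_pos.le
      _ ≤ weight G j j * (run G τbar τ att v (k + m)).val j :=
        mul_le_mul_of_nonneg_right (minWeight_le_weight (Or.inl rfl)) (h1.val j)
      _ ≤ _ := weight_mul_le_step_val h1 j

theorem val_run_pos (hv : ∀ j, 0 < v j) (k : ℕ) (j : V) :
    0 < (run G τbar τ att v k).val j := by
  have h := pow_mul_val_run_le (G := G) (τbar := τbar) (τ := τ) (att := att)
    (nonneg_run_zero fun j => (hv j).le) k j
  rw [zero_add] at h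
  exact (mul_pos (pow_pos minWeight_pos k) (hv j)).trans_le h

theorem minWeight_mul_val_le_of_received {t : ℕ} (h : (run G τbar τ att v t).Nonneg G τbar)
    (hi : i ∈ inNbrs G j) (hτ : τ j i t ≤ τbar j i) :
    minWeight V * (run G τbar τ att v t).val i
      ≤ (run G τbar τ att v (t + τ j i t + 1)).val j := by
  have h1 := nonneg_run_add h (τ j i t)
  calc minWeight V * (run G τbar τ att v t).val i
      ≤ weight G j i * (run G τbar τ att v t).val i :=
        mul_le_mul_of_nonneg_right (minWeight_le_weight (Or.inr hi)) (h.val i)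
    _ ≤ content G (att t) (run G τbar τ att v t) 0 j i := weight_mul_le_content h hi
    _ = content G (att (t + τ j i t)) (run G τbar τ att v (t + τ j i t)) (τ j i t) j i :=
        (content_run_add _ _).symm
    _ ≤ arrival G τbar τ (att (t + τ j i t)) (t + τ j i t) _ j i :=
        content_le_arrival h1 hi hτ (Nat.le_add_left _ _) (by rw [Nat.add_sub_cancel])
    _ ≤ _ := arrival_le_step_val h1 hi

/-- Mass spreads to all nodes in boundedly many slots in which no packet is dropped. -/
theorem exists_spread_time (hG : StronglyConnected G) {B : ℕ}
    (hB : ∀ j, ∀ i ∈ inNbrs G j, τbar j i < B) :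
    ∃ D : ℕ, ∀ (τ : V → V → ℕ → ℕ) (att : ℕ → V → V → Prop) (v : V → ℝ) (a b : ℕ),
      (run G τbar τ att v a).Nonneg G τbar →
      (∀ j, ∀ i ∈ inNbrs G j, ∀ t, a ≤ t → t < b → τ j i t ≤ τbar j i) →
      ∀ i j t, a + D ≤ t → t ≤ b →
        minWeight V ^ (t - a) * (run G τbar τ att v a).val i ≤ (run G τbar τ att v t).val j := by
  have key : ∀ i j, ∃ d : ℕ, ∀ (τ : V → V → ℕ → ℕ) (att : ℕ → V → V → Prop) (v : V → ℝ)
      (a b : ℕ), (run G τbar τ att v a).Nonneg G τbar →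
      (∀ j, ∀ i ∈ inNbrs G j, ∀ t, a ≤ t → t < b → τ j i t ≤ τbar j i) →
      ∀ t, a + d ≤ t → t ≤ b →
        minWeight V ^ (t - a) * (run G τbar τ att v a).val i
          ≤ (run G τbar τ att v t).val j := by
    intro i j
    induction hG i j with
    | refl =>
      refine ⟨0, fun τ att v a b h _ t hat _ => ?_⟩
      obtain ⟨m, rfl⟩ := Nat.exists_eq_add_of_le (show a ≤ t from hat)
      rw [Nat.add_sub_cancel_left]
      exact pow_mul_val_run_le h m i
    | @tail l j _ hlj ih =>
      obtain ⟨d, hd⟩ := ih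
      -- A path may use a self-loop, which is not a link and costs nothing.
      by_cases hne : l = j
      · exact ⟨d, hne ▸ hd⟩
      have hl : l ∈ inNbrs G j := by simp [inNbrs, hne, hlj]
      refine ⟨d + B + 1, fun τ att v a b h hτ t hat htb => ?_⟩
      have hBl := hB j l hl
      -- The packet started in slot `a + d` reaches `j` within `B` slots; for the remaining time `j`
      -- keeps its own share.
      obtain ⟨s, hs1, hs2, hs3⟩ : ∃ s, a + d ≤ s ∧ s + τ j l s + 1 ≤ t ∧ s < b :=
        ⟨a + d, le_rfl, by have := hτ j l hl (a + d) (by omega) (by omega); omega, by omega⟩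
      have hn : (run G τbar τ att v s).Nonneg G τbar := nonneg_run_of_le h (by omega)
      obtain ⟨m, hm⟩ := Nat.exists_eq_add_of_le hs2
      have e1 := hd τ att v a b h hτ s hs1 hs3.le
      have e2 := minWeight_mul_val_le_of_received hn hl (hτ j l hl s (by omega) hs3)
      have e3 := pow_mul_val_run_le (nonneg_run_of_le hn (show s ≤ s + τ j l s + 1 by omega)) m j
      rw [← hm] at e3
      have hp := @minWeight_pos V _
      have hv := h.val i
      calc minWeight V ^ (t - a) * (run G τbar τ att v a).val i
          ≤ minWeight V ^ (m + 1 + (s - a)) * (run G τbar τ att v a).val i :=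
            mul_le_mul_of_nonneg_right
              (pow_le_pow_of_le_one hp.le minWeight_le_one (by omega)) hv
        _ = minWeight V ^ m * (minWeight V *
              (minWeight V ^ (s - a) * (run G τbar τ att v a).val i)) := by ring
        _ ≤ minWeight V ^ m * (run G τbar τ att v (s + τ j l s + 1)).val j :=
            mul_le_mul_of_nonneg_left
              ((mul_le_mul_of_nonneg_left e1 hp.le).trans e2) (pow_nonneg hp.le _)
        _ ≤ _ := e3
  choose d hd using key
  refine ⟨∑ i, ∑ j, d i j, fun τ att v a b h hτ i j t hat htb =>
    hd i j τ att v a b h hτ t (le_trans ?_ hat) htb⟩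
  have h1 : d i j ≤ ∑ j, d i j := Finset.single_le_sum (fun _ _ => Nat.zero_le _) (Finset.mem_univ j)
  have h2 : ∑ j, d i j ≤ ∑ i, ∑ j, d i j :=
    Finset.single_le_sum (f := fun i => ∑ j, d i j) (fun _ _ => Nat.zero_le _) (Finset.mem_univ i)
  omega

/-- In the slots `k, …, k + K - 1` every packet started is received at its last trial, except on
links that never fail. -/
def IsGoodWindow (G : Digraph V) (τbar : V → V → ℕ) (τ : V → V → ℕ → ℕ) (k K : ℕ) : Prop :=
  ∀ j, ∀ i ∈ inNbrs G j, (∀ t, τ j i t = 0) ∨ ∀ t, k ≤ t → t < k + K → τ j i t = τbar j i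

/-- If `τbar j i = 0`, every first trial is also a successful last trial; otherwise no packet ever
comes to its last trial and the running sum receives nothing. -/
theorem sum_eq_recv_of_delay_eq_zero (h : ∀ t, τ j i t = 0) (t : ℕ) :
    (run G τbar τ att v t).sum j i = (run G τbar τ att v t).recv j i := by
  induction t with
  | zero => rfl
  | succ t ih =>
    change newSum _ _ _ _ _ _ _ _ = newRecv _ _ _ _ _ _ _ _
    by_cases h0 : τbar j i = 0
    · rw [newRecv, if_pos (by simp [h, h0])]
    · rw [newRecv, if_neg (by simp [h, Ne.symm h0]), newSum, if_neg (by simp [h, h0]),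
        attached_of_sum_eq_recv ih, ih]
      ring

/-- Once `B` slots have passed, every slot contains the successful last trial of a packet started in
the window. -/
theorem IsGoodWindow.sum_eq_recv {k K B t : ℕ} (hw : IsGoodWindow G τbar τ k K)
    (hB : ∀ j, ∀ i ∈ inNbrs G j, τbar j i < B) (hi : i ∈ inNbrs G j)
    (hkt : k + B ≤ t) (htK : t ≤ k + K) :
    (run G τbar τ att v t).sum j i = (run G τbar τ att v t).recv j i := by
  rcases hw j i hi with h | h
  · exact sum_eq_recv_of_delay_eq_zero h t
  · have := hB j i hi
    obtain ⟨s, rfl⟩ : ∃ s, t = s + 1 := ⟨t - 1, by omega⟩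
    change newSum _ _ _ _ _ _ _ _ = newRecv _ _ _ _ _ _ _ _
    rw [newRecv, if_pos ⟨by omega, h _ (by omega) (by omega)⟩]

/-- After `2 * B` slots, all packets of age below `B` were created when there was nothing withheld
to attach. -/
theorem IsGoodWindow.sent_eq {k K B t r : ℕ} (hw : IsGoodWindow G τbar τ k K)
    (hB : ∀ j, ∀ i ∈ inNbrs G j, τbar j i < B) (hi : i ∈ inNbrs G j) (hr : r < B)
    (hkt : k + 2 * B ≤ t) (htK : t ≤ k + K) :
    (run G τbar τ att v t).sent r j i
      = weight G j i * (run G τbar τ att v (t - (r + 1))).val i := by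
  obtain ⟨s, rfl⟩ : ∃ s, t = s + r + 1 := ⟨t - (r + 1), by omega⟩
  rw [show s + r + 1 - (r + 1) = s by omega]
  have h1 : (run G τbar τ att v (s + r + 1)).sent r j i
      = content G (att s) (run G τbar τ att v s) 0 j i := content_run_add s r
  rw [h1, content, attached_of_sum_eq_recv (hw.sum_eq_recv hB hi (by omega) (by omega)),
    add_zero]

/-- The nodes hold a fixed fraction of the mass: a packet in flight was cut from its sender's value
at most `B` slots ago, and the sender has kept at least `minWeight V ^ B` of that value. -/
theorem IsGoodWindow.pow_mul_sum_le {k K B a : ℕ} (hw : IsGoodWindow G τbar τ k K)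
    (hB : ∀ j, ∀ i ∈ inNbrs G j, τbar j i < B)
    (h : (run G τbar τ att v k).Nonneg G τbar) (hka : k + 2 * B ≤ a) (haK : a ≤ k + K) :
    minWeight V ^ B * ∑ j, v j
      ≤ (1 + Fintype.card V * B) * ∑ i, (run G τbar τ att v a).val i := by
  have hp := @minWeight_pos V _
  have ha : (run G τbar τ att v a).Nonneg G τbar := nonneg_run_of_le h (by omega)
  have hle1 : minWeight V ^ B ≤ 1 := pow_le_one₀ hp.le minWeight_le_one
  have key : ∀ j, ∀ i ∈ inNbrs G j, minWeight V ^ B *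
      ((run G τbar τ att v a).sum j i - (run G τbar τ att v a).recv j i
        + inFlight τbar τ a (run G τbar τ att v a) j i)
      ≤ B * (run G τbar τ att v a).val i := by
    intro j i hi
    rw [hw.sum_eq_recv hB hi (by omega) haK, sub_self, zero_add, inFlight, Finset.mul_sum]
    have hterm : ∀ r ∈ Finset.range (τbar j i), minWeight V ^ B *
        (if r + 1 ≤ a ∧ r + 1 ≤ τ j i (a - (r + 1)) then (run G τbar τ att v a).sent r j i
          else 0) ≤ (run G τbar τ att v a).val i := by
      intro r hr
      have hrB : r < B := (Finset.mem_range.1 hr).trans (hB j i hi)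
      split_ifs
      · have hs : (run G τbar τ att v (a - (r + 1))).Nonneg G τbar :=
          nonneg_run_of_le h (by omega)
        have e := pow_mul_val_run_le hs (r + 1) i
        rw [Nat.sub_add_cancel (by omega)] at e
        rw [hw.sent_eq hB hi hrB hka haK]
        refine le_trans ?_ e
        refine mul_le_mul (pow_le_pow_of_le_one hp.le minWeight_le_one hrB) ?_
          (mul_nonneg (weight_nonneg _ _ _) (hs.val i)) (pow_nonneg hp.le _)
        exact mul_le_of_le_one_left (hs.val i) (weight_le_one _ _ _)
      · rw [mul_zero]
        exact ha.val i
    refine (Finset.sum_le_card_nsmul _ _ _ hterm).trans ?_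
    rw [Finset.card_range, nsmul_eq_mul]
    exact mul_le_mul_of_nonneg_right (by exact_mod_cast (hB j i hi).le) (ha.val i)
  have hsum : ∀ j, minWeight V ^ B * ((run G τbar τ att v a).val j + ∑ i ∈ inNbrs G j,
      ((run G τbar τ att v a).sum j i - (run G τbar τ att v a).recv j i
        + inFlight τbar τ a (run G τbar τ att v a) j i))
      ≤ (run G τbar τ att v a).val j + B * ∑ i, (run G τbar τ att v a).val i := by
    intro j
    rw [mul_add, Finset.mul_sum, Finset.mul_sum]
    refine add_le_add (mul_le_of_le_one_left (ha.val j) hle1) ?_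
    refine (Finset.sum_le_sum (key j)).trans ?_
    exact Finset.sum_le_sum_of_subset_of_nonneg (Finset.subset_univ _)
      fun i _ _ => mul_nonneg (Nat.cast_nonneg _) (ha.val i)
  rw [← mass_run (G := G) (τbar := τbar) (τ := τ) (att := att) a, mass, Finset.mul_sum]
  refine (Finset.sum_le_sum fun j _ => hsum j).trans_eq ?_
  rw [Finset.sum_add_distrib, Finset.sum_const, Finset.card_univ, nsmul_eq_mul]
  ring

/-- A long enough good window mixes: every value and every packet content at its end is
comparable with that of the run started from the constant average, and nothing is withheld. -/
theorem exists_contraction [Nonempty V] (hG : StronglyConnected G) (τbar : V → V → ℕ) :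
    ∃ (K : ℕ) (ε : ℝ), 0 < K ∧ 0 < ε ∧ ε < 1 ∧
      ∀ (τ : V → V → ℕ → ℕ) (att : ℕ → V → V → Prop) (v : V → ℝ) (k : ℕ),
        IsGoodWindow G τbar τ k K → 0 ≤ ∑ j, v j → (run G τbar τ att v k).Nonneg G τbar →
        (run G τbar τ att
          (fun j => 1 * v j + (-(ε * ((∑ i, v i) / Fintype.card V))) * 1) (k + K)).Nonneg
            G τbar := by
  obtain ⟨B, hB⟩ : ∃ B, ∀ j, ∀ i ∈ inNbrs G j, τbar j i < B := by
    refine ⟨(∑ j, ∑ i, τbar j i) + 1, fun j i _ => ?_⟩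
    have h1 : τbar j i ≤ ∑ i, τbar j i :=
      Finset.single_le_sum (fun _ _ => Nat.zero_le _) (Finset.mem_univ i)
    have h2 : ∑ i, τbar j i ≤ ∑ j, ∑ i, τbar j i :=
      Finset.single_le_sum (f := fun j => ∑ i, τbar j i) (fun _ _ => Nat.zero_le _)
        (Finset.mem_univ j)
    omega
  obtain ⟨D, hD⟩ := exists_spread_time hG hB
  have hp := @minWeight_pos V _
  have hN : (0 : ℝ) < Fintype.card V := by exact_mod_cast Fintype.card_pos
  set N : ℝ := (Fintype.card V : ℝ) with hNdef
  -- `minWeight V ^ (D + B)` is the loss in spreading for up to `D + B` slots, `minWeight V ^ B / (1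
  -- + N * B)` the fraction of mass at the nodes, and `1 / N` comes from summing over the source
  -- nodes.
  set δ : ℝ := minWeight V ^ (D + B) * minWeight V ^ B / (N * (1 + N * B)) with hδ
  have hδpos : 0 < δ := by positivity
  -- `2 * B` slots clear the withheld amounts and old packets, `D` slots spread the mass, and `B`
  -- more ensure that all relevant packets at the end were cut from values already bounded below.
  -- The extra slot makes the length positive.
  refine ⟨3 * B + D + 1, min δ (1 / 2), by omega, lt_min hδpos (by norm_num),
    (min_le_right _ _).trans_lt (by norm_num), fun τ att v k hw hv h => ?_⟩
  set K := 3 * B + D + 1 with hK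
  set ε := min δ (1 / 2) with hε
  have hε0 : 0 ≤ ε := (lt_min hδpos (by norm_num)).le
  have hrec : ∀ j, ∀ i ∈ inNbrs G j, ∀ t, k + 2 * B ≤ t → t < k + K → τ j i t ≤ τbar j i := by
    intro j i hi t h1 h2
    rcases hw j i hi with h | h
    · simp [h]
    · exact (h t (by omega) h2).le
  have ha : (run G τbar τ att v (k + 2 * B)).Nonneg G τbar := nonneg_run_of_le h (by omega)
  have hlow : ∀ j t, k + 2 * B + D ≤ t → t ≤ k + 3 * B + D →
      ε * ∑ i, v i ≤ (run G τbar τ att v t).val j := by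
    intro j t h1 h2
    have e1 : ∀ i, minWeight V ^ (D + B) * (run G τbar τ att v (k + 2 * B)).val i
        ≤ (run G τbar τ att v t).val j := fun i =>
      (mul_le_mul_of_nonneg_right (pow_le_pow_of_le_one hp.le minWeight_le_one (by omega))
        (ha.val i)).trans
        (hD τ att v (k + 2 * B) (k + K) ha hrec i j t h1 (by omega))
    have e2 : minWeight V ^ (D + B) * ∑ i, (run G τbar τ att v (k + 2 * B)).val i
        ≤ N * (run G τbar τ att v t).val j := by
      rw [Finset.mul_sum]
      refine (Finset.sum_le_card_nsmul _ _ _ fun i _ => e1 i).trans_eq ?_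
      rw [Finset.card_univ, nsmul_eq_mul]
    have e3 := hw.pow_mul_sum_le (att := att) hB h le_rfl (show k + 2 * B ≤ k + K by omega)
    rw [← hNdef] at e3
    have e4 : minWeight V ^ (D + B) * (minWeight V ^ B * ∑ i, v i)
        ≤ (1 + N * B) * (N * (run G τbar τ att v t).val j) := by
      refine (mul_le_mul_of_nonneg_left e3 (pow_nonneg hp.le (D + B))).trans ?_
      rw [mul_left_comm]
      exact mul_le_mul_of_nonneg_left e2 (by positivity)
    refine (mul_le_mul_of_nonneg_right (min_le_left _ _) hv).trans ?_
    rw [hδ, div_mul_eq_mul_div, div_le_iff₀ (by positivity)]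
    linarith
  have hval : ∀ j t, k + 2 * B + D ≤ t → t ≤ k + 3 * B + D → 0 ≤
      1 * (run G τbar τ att v t).val j + (-(ε * ((∑ i, v i) / N)))
        * (run G τbar τ att (fun _ => 1) t).val j := by
    intro j t h1 h2
    have e1 := hlow j t h1 h2
    have hn : (run G τbar τ att (fun _ => 1) t).Nonneg G τbar :=
      nonneg_run_of_le (nonneg_run_zero fun _ => zero_le_one) (Nat.zero_le t)
    -- The run from the constant `1` has total mass `N`, so the subtracted term is at most `ε * ∑ i,
    -- v i`.
    have e2 := val_run_le_sum hn j
    rw [Finset.sum_const, Finset.card_univ, nsmul_eq_mul, mul_one, ← hNdef] at e2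
    have e3 : ε * ((∑ i, v i) / N) * (run G τbar τ att (fun _ => 1) t).val j
        ≤ ε * ((∑ i, v i) / N) * N := mul_le_mul_of_nonneg_left e2 (by positivity)
    have e4 : ε * ((∑ i, v i) / N) * N = ε * ∑ i, v i := by field_simp
    linarith
  have hend : (run G τbar τ att
      (fun j => 1 * v j + (-(ε * ((∑ i, v i) / N))) * 1) (k + (3 * B + D))).Nonneg G τbar := by
    rw [run_comb]
    refine ⟨fun j => hval j _ (by omega) (by omega), fun j i hi r hr => ?_, fun j i hi => ?_⟩
    · have hrB := hr.trans (hB j i hi)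
      change 0 ≤ _ * State.sent _ r j i + _ * State.sent _ r j i
      rw [hw.sent_eq hB hi hrB (by omega) (by omega), hw.sent_eq hB hi hrB (by omega) (by omega)]
      have := mul_nonneg (weight_nonneg G j i)
        (hval i (k + (3 * B + D) - (r + 1)) (by omega) (by omega))
      linarith
    · change _ * State.recv _ j i + _ * State.recv _ j i
        ≤ _ * State.sum _ j i + _ * State.sum _ j i
      rw [hw.sum_eq_recv hB hi (by omega) (by omega), hw.sum_eq_recv hB hi (by omega) (by omega)]
  exact nonneg_run_of_le hend (by omega)

end Run

/-! ### Convergence of the ratio when good windows recur -/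

section Convergence

variable {G : Digraph V} {τbar : V → V → ℕ} {τ : V → V → ℕ → ℕ} {att : ℕ → V → V → Prop}

/-- As `d` sums to zero, the average of `d + C * (1 - ε) ^ m` is its constant part, so each further
window multiplies that part by `1 - ε`. -/
theorem exists_nonneg_bound_of_frequently {K : ℕ} {ε : ℝ} (hε : ε < 1) [Nonempty V]
    (hcontr : ∀ (v : V → ℝ) (k : ℕ),
        IsGoodWindow G τbar τ k K → 0 ≤ ∑ j, v j → (run G τbar τ att v k).Nonneg G τbar →
        (run G τbar τ att
          (fun j => 1 * v j + (-(ε * ((∑ i, v i) / Fintype.card V))) * 1) (k + K)).Nonneg G τbar)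
    (hfreq : ∃ᶠ k in atTop, IsGoodWindow G τbar τ k K)
    {d : V → ℝ} (hd : ∑ i, d i = 0) {C : ℝ} (hC : 0 ≤ C) (hdC : ∀ i, 0 ≤ d i + C) (m : ℕ) :
    ∃ k, ∀ l ≥ k, (run G τbar τ att (fun i => d i + C * (1 - ε) ^ m) l).Nonneg G τbar := by
  have hN : (Fintype.card V : ℝ) ≠ 0 := by exact_mod_cast Fintype.card_ne_zero
  induction m with
  | zero =>
    refine ⟨0, fun l hl => nonneg_run_of_le (nonneg_run_zero fun j => ?_) hl⟩
    simpa using hdC j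
  | succ m ih =>
    obtain ⟨k, hk⟩ := ih
    obtain ⟨l, hl, hw⟩ := frequently_atTop.1 hfreq k
    have hsum : ∑ i, (d i + C * (1 - ε) ^ m) = Fintype.card V * (C * (1 - ε) ^ m) := by
      rw [Finset.sum_add_distrib, hd, Finset.sum_const, Finset.card_univ, nsmul_eq_mul, zero_add]
    have hpos : 0 ≤ C * (1 - ε) ^ m := mul_nonneg hC (pow_nonneg (by linarith) _)
    have h := hcontr _ l hw (by rw [hsum]; positivity) (hk l hl)
    refine ⟨l + K, fun t ht => nonneg_run_of_le ?_ ht⟩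
    convert h using 2
    funext j
    rw [hsum, mul_div_cancel_left₀ _ hN]
    ring

theorem tendsto_ratio {K : ℕ} {ε : ℝ} (hε0 : 0 < ε) (hε : ε < 1)
    (hcontr : ∀ (v : V → ℝ) (k : ℕ),
        IsGoodWindow G τbar τ k K → 0 ≤ ∑ j, v j → (run G τbar τ att v k).Nonneg G τbar →
        (run G τbar τ att
          (fun j => 1 * v j + (-(ε * ((∑ i, v i) / Fintype.card V))) * 1) (k + K)).Nonneg G τbar)
    (hfreq : ∃ᶠ k in atTop, IsGoodWindow G τbar τ k K) (x₀ : V → ℝ) (j : V) :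
    Tendsto (fun k => (run G τbar τ att x₀ k).val j / (run G τbar τ att (fun _ => 1) k).val j)
      atTop (𝓝 ((∑ i, x₀ i) / (Fintype.card V : ℝ))) := by
  have : Nonempty V := ⟨j⟩
  have hN : (Fintype.card V : ℝ) ≠ 0 := by exact_mod_cast Fintype.card_ne_zero
  set c := (∑ i, x₀ i) / (Fintype.card V : ℝ) with hc
  obtain ⟨C, hC, hxC⟩ : ∃ C : ℝ, 0 ≤ C ∧ ∀ i, |x₀ i - c| ≤ C :=
    ⟨∑ i, |x₀ i - c|, Finset.sum_nonneg fun _ _ => abs_nonneg _, fun i =>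
      Finset.single_le_sum (f := fun i => |x₀ i - c|) (fun _ _ => abs_nonneg _)
        (Finset.mem_univ i)⟩
  have hsum : ∑ i, (x₀ i - c) = 0 := by
    rw [Finset.sum_sub_distrib, Finset.sum_const, Finset.card_univ, nsmul_eq_mul, hc,
      mul_div_cancel₀ _ hN, sub_self]
  have hbound : ∀ m, ∀ᶠ k in atTop,
      |(run G τbar τ att x₀ k).val j / (run G τbar τ att (fun _ => 1) k).val j - c|
        ≤ C * (1 - ε) ^ m := by
    intro m
    obtain ⟨k₁, h₁⟩ := exists_nonneg_bound_of_frequently (att := att) hε hcontr hfreq hsum hC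
      (fun i => by linarith [neg_abs_le (x₀ i - c), hxC i]) m
    obtain ⟨k₂, h₂⟩ := exists_nonneg_bound_of_frequently (att := att) (d := fun i => -(x₀ i - c))
      hε hcontr hfreq (by rw [Finset.sum_neg_distrib, hsum, neg_zero]) hC
      (fun i => by linarith [le_abs_self (x₀ i - c), hxC i]) m
    filter_upwards [eventually_ge_atTop k₁, eventually_ge_atTop k₂] with k hk₁ hk₂
    have hy : 0 < (run G τbar τ att (fun _ => 1) k).val j := val_run_pos (fun _ => one_pos) k j
    have e₁ := (h₁ k hk₁).val j
    have e₂ := (h₂ k hk₂).val j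
    -- Written as combinations of `x₀` and the constant `1`, the two cone memberships become the
    -- lower and upper bounds on `x - c * y`.
    rw [show (fun i => x₀ i - c + C * (1 - ε) ^ m)
      = fun i => 1 * x₀ i + (C * (1 - ε) ^ m - c) * 1 by funext i; ring, run_comb] at e₁
    rw [show (fun i => -(x₀ i - c) + C * (1 - ε) ^ m)
      = fun i => -1 * x₀ i + (C * (1 - ε) ^ m + c) * 1 by funext i; ring, run_comb] at e₂
    simp only [State.comb] at e₁ e₂
    rw [div_sub' hy.ne', abs_div, abs_of_pos hy, div_le_iff₀ hy, abs_le]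
    constructor <;> linarith
  rw [Metric.tendsto_atTop']
  intro e he
  have hlim : Tendsto (fun m => C * (1 - ε) ^ m) atTop (𝓝 0) := by
    simpa using (tendsto_pow_atTop_nhds_zero_of_lt_one (by linarith) (by linarith)).const_mul C
  obtain ⟨m, hm⟩ := (hlim.eventually_lt_const he).exists
  obtain ⟨k, hk⟩ := eventually_atTop.1 (hbound m)
  exact ⟨k, fun l hl => (hk l hl.le).trans_lt hm⟩

end Convergence

/-! ### Good windows recur almost surely -/

section Probability

variable {Ω : Type*} [MeasurableSpace Ω] {μ : Measure Ω} {G : Digraph V}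
  {τbar : V → V → ℕ} {q : V → V → ℝ} {τ : V → V → ℕ → Ω → ℕ}

/-- An independent family of countably valued variables that take prescribed values with
probabilities not depending on time does so, almost surely, on infinitely many blocks. -/
theorem ae_frequently_block [IsProbabilityMeasure μ] {L : Type*} [Finite L] {X : L × ℕ → Ω → ℕ}
    (hX : ∀ a, Measurable (X a)) (hind : iIndepFun X μ) (c : L → ℕ) {p : L → ENNReal}
    (hp : ∀ a, μ (X a ⁻¹' {c a.1}) = p a.1) (hp0 : ∀ l, p l ≠ 0) (K : ℕ) :
    ∀ᵐ ω ∂μ, ∃ᶠ m in atTop, ∀ l t, K * m ≤ t → t < K * m + K → X (l, t) ω = c l := by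
  classical
  have := Fintype.ofFinite L
  let I : ℕ → Finset (L × ℕ) := fun m => Finset.univ ×ˢ Finset.Ico (K * m) (K * m + K)
  let E : ℕ → Set Ω := fun m => ⋂ a ∈ I m, X a ⁻¹' {c a.1}
  have hEmeas : ∀ m, MeasurableSet (E m) := fun m =>
    Finset.measurableSet_biInter _ fun a _ => hX a (measurableSet_singleton _)
  have hprod : ∀ s : Finset (L × ℕ), μ (⋂ a ∈ s, X a ⁻¹' {c a.1}) = ∏ a ∈ s, p a.1 := by
    intro s
    rw [hind.measure_inter_preimage_eq_mul s (sets := fun a => {c a.1})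
      fun a _ => measurableSet_singleton _]
    exact Finset.prod_congr rfl fun a _ => hp a
  have hEval : ∀ m, μ (E m) = ∏ l, p l ^ K := by
    intro m
    rw [hprod, Finset.prod_product]
    simp
  have hdisj : ∀ s : Finset ℕ, (s : Set ℕ).PairwiseDisjoint I := by
    intro s m _ m' _ hne
    rw [Function.onFun, Finset.disjoint_left]
    rintro ⟨l, t⟩ h h'
    simp only [I, Finset.mem_product, Finset.mem_univ, true_and, Finset.mem_Ico] at h h'
    apply hne
    have e : ∀ m, K * m ≤ t ∧ t < K * m + K → t / K = m := fun m h =>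
      Nat.div_eq_of_lt_le (by rw [mul_comm]; exact h.1)
        (by rw [mul_comm, mul_add, mul_one]; exact h.2)
    rw [← e m h, ← e m' h']
  -- An intersection of block events is one event over the union of disjoint blocks, so its
  -- probability factors.
  have hEind : iIndepSet E μ := by
    rw [iIndepSet_iff_meas_biInter hEmeas]
    intro s
    have h1 : ⋂ m ∈ s, E m = ⋂ a ∈ s.biUnion I, X a ⁻¹' {c a.1} := by
      ext ω
      simp only [E, Set.mem_iInter, Finset.mem_biUnion]
      exact ⟨fun h a ⟨m, hm, ha⟩ => h m hm a ha, fun h m hm a ha => h a ⟨m, hm, ha⟩⟩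
    rw [h1, hprod, Finset.prod_biUnion (hdisj s)]
    exact Finset.prod_congr rfl fun m _ => (hprod _).symm
  have hne : ∏ l, p l ^ K ≠ 0 := Finset.prod_ne_zero_iff.2 fun l _ => pow_ne_zero _ (hp0 l)
  have hlim : μ (limsup E atTop) = 1 := by
    refine measure_limsup_eq_one hEmeas hEind ?_
    simp only [hEval]
    exact ENNReal.tsum_const_eq_top_of_ne_zero hne
  have hae : ∀ᵐ ω ∂μ, ω ∈ limsup E atTop :=
    (mem_ae_iff_prob_eq_one (MeasurableSet.measurableSet_limsup hEmeas)).2 hlim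
  filter_upwards [hae] with ω hω
  rw [mem_limsup_iff_frequently_mem] at hω
  refine hω.mono fun m hm l t h1 h2 => ?_
  have := Set.mem_iInter₂.1 hm (l, t) (by simp [I, h1, h2])
  simpa using this

theorem IsARQDelay.ae_frequently_isGoodWindow [IsProbabilityMeasure μ]
    (hτ : IsARQDelay μ G τbar q τ)
    (hq : ∀ j, ∀ i ∈ inNbrs G j, 0 ≤ q j i ∧ q j i < 1) {K : ℕ} (hK : 0 < K) :
    ∀ᵐ ω ∂μ, ∃ᶠ k in atTop, IsGoodWindow G τbar (fun j i k => τ j i k ω) k K := by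
  classical
  have : Finite (Link G) := inferInstanceAs (Finite {e : V × V // e.2 ∈ inNbrs G e.1})
  -- For `q = 0` a positive delay has probability zero, so the prescribed delay must be `0` there to
  -- keep the probability of a block positive.
  let c : Link G → ℕ := fun l => if q l.1.1 l.1.2 = 0 then 0 else τbar l.1.1 l.1.2
  let p : Link G → ℝ := fun l => q l.1.1 l.1.2 ^ c l * (1 - q l.1.1 l.1.2)
  have hp0 : ∀ l, ENNReal.ofReal (p l) ≠ 0 := by
    intro l
    obtain ⟨h0, h1⟩ := hq l.1.1 l.1.2 l.2
    rw [Ne, ENNReal.ofReal_eq_zero, not_le]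
    refine mul_pos ?_ (sub_pos.2 h1)
    by_cases h : q l.1.1 l.1.2 = 0
    · simp [c, h]
    · exact pow_pos (h0.lt_of_ne' h) _
  have hblock := ae_frequently_block (μ := μ) (L := Link G)
    (X := fun a => τ a.1.1.1 a.1.1.2 a.2) (fun a => hτ.measurable _ _ a.1.2 _) hτ.indep c
    (p := fun l => ENNReal.ofReal (p l)) (fun a => by
      have hle : c a.1 ≤ τbar a.1.1.1 a.1.1.2 := by
        simp only [c]
        split_ifs
        exacts [Nat.zero_le _, le_rfl]
      have h := hτ.prob_delay a.1.1.1 a.1.1.2 a.1.2 a.2 (c a.1) hle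
      exact (ofReal_measureReal (measure_ne_top _ _)).symm.trans (congrArg ENNReal.ofReal h)) hp0 K
  -- A block controls only its own slots, whereas links with `q = 0` need delay zero at all times.
  have hzero : ∀ᵐ ω ∂μ, ∀ (l : Link G) (t : ℕ), q l.1.1 l.1.2 = 0 → τ l.1.1 l.1.2 t ω = 0 := by
    rw [ae_all_iff]
    intro l
    rw [ae_all_iff]
    intro t
    by_cases h : q l.1.1 l.1.2 = 0
    · have h1 := hτ.prob_delay l.1.1 l.1.2 l.2 t 0 (Nat.zero_le _)
      rw [pow_zero, h, sub_zero, mul_one] at h1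
      have h2 : μ {ω | τ l.1.1 l.1.2 t ω = 0} = 1 := by
        rw [← ofReal_measureReal, h1, ENNReal.ofReal_one]
      have hm : MeasurableSet {ω | τ l.1.1 l.1.2 t ω = 0} :=
        hτ.measurable _ _ l.2 t (measurableSet_singleton 0)
      filter_upwards [(mem_ae_iff_prob_eq_one hm).2 h2] with ω hω _
      exact hω
    · exact Eventually.of_forall fun ω h' => absurd h' h
  filter_upwards [hblock, hzero] with ω hω hω0
  have htend : Tendsto (fun m => K * m) atTop atTop :=
    tendsto_id.const_mul_atTop' hK
  refine htend.frequently (hω.mono fun m hm j i hi => ?_)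
  by_cases h : q j i = 0
  · exact Or.inl fun t => hω0 ⟨(j, i), hi⟩ t h
  · right
    intro t h1 h2
    have := hm ⟨(j, i), hi⟩ t h1 h2
    simpa [c, h] using this

end Probability

end ARQ

end

theorem theorem1 {V : Type*} [Fintype V] (G : Digraph V) (hG : ARQ.StronglyConnected G)
    {Ω : Type*} [MeasurableSpace Ω] (μ : Measure Ω) [IsProbabilityMeasure μ]
    (τbar : V → V → ℕ) (q : V → V → ℝ)
    (hq : ∀ j, ∀ i ∈ ARQ.inNbrs G j, 0 ≤ q j i ∧ q j i < 1)
    (τ : V → V → ℕ → Ω → ℕ) (hτ : ARQ.IsARQDelay μ G τbar q τ)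
    (attach : Ω → ℕ → V → V → Prop) (x₀ : V → ℝ)
    (x y z : Ω → ℕ → V → ℝ)
    (hx : ∀ ω k j,
      x ω k j = (ARQ.run G τbar (fun j i k => τ j i k ω) (attach ω) x₀ k).val j)
    (hy : ∀ ω k j,
      y ω k j = (ARQ.run G τbar (fun j i k => τ j i k ω) (attach ω) (fun _ => 1) k).val j)
    (hz : ∀ ω k j, z ω k j = x ω k j / y ω k j) :
    ∀ᵐ ω ∂μ, ∀ j : V, (∀ k, 0 < y ω k j) ∧
      Tendsto (fun k => z ω k j) atTop (𝓝 ((∑ i, x₀ i) / (Fintype.card V : ℝ))) := by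
  rcases isEmpty_or_nonempty V with hV | hV
  · exact Eventually.of_forall fun _ j => hV.elim j
  obtain ⟨K, ε, hK, hε0, hε1, hcontr⟩ := ARQ.exists_contraction hG τbar
  filter_upwards [hτ.ae_frequently_isGoodWindow hq hK] with ω hω j
  refine ⟨fun k => ?_, ?_⟩
  · rw [hy]
    exact ARQ.val_run_pos (fun _ => one_pos) k j
  · simp only [hz, hx, hy]
    exact ARQ.tendsto_ratio hε0 hε1 (hcontr _ (attach ω)) hω x₀ j
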